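/- Let $k$ be a field and let $A=k[[t^5,t^6,t^9]]\subseteq k[[t]]$ be the semigroup ring of the numerical semigroup $H=\langle 5,6,9\rangle$, that is, the ring of all formal power series $\sum_{n\in H}c_nt^n$ with $c_n\in k$; it is a one-dimensional Cohen–Macaulay local ring. An ideal $I$ of a Cohen–Macaulay local ring $(R,\mathfrak m)$ is called an Ulrich ideal if it is $\mathfrak m$-primary, there is a parameter ideal $Q\subseteq I$ (an $\mathfrak m$-primary ideal generated by $\dim R$ elements) with $I\ne Q$ and $I^2=QI$, and $I/I^2$ is a free $R/I$-module. Let $\mathcal X_A$ denote the set of Ulrich ideals of $A$. Then $$\mathcal X_A=\{(t^6+\alpha t^{10},\ t^9+\beta t^{10}) \mid \alpha,\beta\in k,\ 2\beta=0\}.$$ Moreover, for each $I\in\mathcal X_A$ the elements $\alpha,\beta\in k$ in an expression $I=(t^6+\alpha t^{10},\ t^9+\beta t^{10})$ are uniquely determined by $I$. -/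

import Mathlib

open PowerSeries

/-- The semigroup ring `k[[H]]` of a submonoid `H` of `ℕ`: the subalgebra of `k[[t]]` of all formal
power series `∑ cₙ tⁿ` with `cₙ = 0` for every `n ∉ H`.  For `H = ⟨a₁, …, aₗ⟩` this is the ring
`k[[t^{a₁}, …, t^{aₗ}]]` of all power series in `t^{a₁}, …, t^{aₗ}`. -/
def semigroupRing (k : Type*) [Field k] (H : AddSubmonoid ℕ) : Subalgebra k k⟦X⟧ where
  carrier := {f | ∀ n, n ∉ H → coeff n f = 0}
  mul_mem' := by
    intro f g hf hg n hn
    rw [coeff_mul]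
    refine Finset.sum_eq_zero fun p hp => ?_
    rw [Finset.HasAntidiagonal.mem_antidiagonal] at hp
    by_cases h1 : p.1 ∈ H
    · have h2 : p.2 ∉ H := fun h2 => hn (hp ▸ H.add_mem h1 h2)
      rw [hg _ h2, mul_zero]
    · rw [hf _ h1, zero_mul]
  add_mem' := by
    intro f g hf hg n hn
    rw [map_add, hf n hn, hg n hn, add_zero]
  algebraMap_mem' := by
    intro r n hn
    have h0 : n ≠ 0 := fun h => hn (h ▸ H.zero_mem)
    rw [PowerSeries.algebraMap_apply, coeff_C, if_neg h0]

theorem mem_semigroupRing {k : Type*} [Field k] {H : AddSubmonoid ℕ} {f : k⟦X⟧} :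
    f ∈ semigroupRing k H ↔ ∀ n, n ∉ H → coeff n f = 0 := Iff.rfl

theorem inv_mem_semigroupRing {k : Type*} [Field k] {H : AddSubmonoid ℕ} {f : k⟦X⟧}
    (hf : f ∈ semigroupRing k H) : f⁻¹ ∈ semigroupRing k H := by
  rw [mem_semigroupRing] at hf ⊢
  intro n
  induction n using Nat.strong_induction_on with
  | _ n ih =>
    intro hn
    have h0 : n ≠ 0 := fun h => hn (h ▸ H.zero_mem)
    rw [coeff_inv, if_neg h0]
    refine mul_eq_zero_of_right _ (Finset.sum_eq_zero fun p hp => ?_)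
    rw [Finset.HasAntidiagonal.mem_antidiagonal] at hp
    split_ifs with hlt
    · by_cases h1 : p.1 ∈ H
      · have h2 : p.2 ∉ H := fun h2 => hn (hp ▸ H.add_mem h1 h2)
        rw [ih _ hlt h2, mul_zero]
      · rw [hf _ h1, zero_mul]
    · rfl

theorem isUnit_semigroupRing_of_constantCoeff_ne_zero {k : Type*} [Field k] {H : AddSubmonoid ℕ}
    (f : semigroupRing k H) (hf : constantCoeff (f : k⟦X⟧) ≠ 0) : IsUnit f :=
  IsUnit.of_mul_eq_one ⟨(f : k⟦X⟧)⁻¹, inv_mem_semigroupRing f.2⟩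
    (Subtype.ext (PowerSeries.mul_inv_cancel _ hf))

instance semigroupRing_isLocalRing (k : Type*) [Field k] (H : AddSubmonoid ℕ) :
    IsLocalRing (semigroupRing k H) := by
  refine IsLocalRing.of_isUnit_or_isUnit_of_isUnit_add fun a b hab => ?_
  have h : constantCoeff (a : k⟦X⟧) + constantCoeff (b : k⟦X⟧) ≠ 0 := by
    have := (hab.map (semigroupRing k H).val).map (constantCoeff (R := k))
    simpa using this.ne_zero
  by_cases ha : constantCoeff (a : k⟦X⟧) = 0
  · right
    refine isUnit_semigroupRing_of_constantCoeff_ne_zero b fun hb => h ?_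
    rw [ha, hb, add_zero]
  · exact Or.inl (isUnit_semigroupRing_of_constantCoeff_ne_zero a ha)

/-- The element `tⁿ` of `k[[H]]`, for `n ∈ H`. -/
noncomputable def tPow (k : Type*) [Field k] {H : AddSubmonoid ℕ} (n : ℕ) (hn : n ∈ H) :
    semigroupRing k H :=
  ⟨X ^ n, by
    rw [mem_semigroupRing]
    intro m hm
    rw [coeff_X_pow, if_neg]
    rintro rfl
    exact hm hn⟩

/-- A parameter ideal of a (Noetherian) local ring `A`: an ideal `Q` generated by `dim A` elements
whose radical is the maximal ideal. -/
def IsParameterIdeal {A : Type*} [CommRing A] [IsLocalRing A] (Q : Ideal A) : Prop :=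
  Q.radical = IsLocalRing.maximalIdeal A ∧
    ∃ s : Finset A, (s.card : WithBot ℕ∞) = ringKrullDim A ∧ Q = Ideal.span (s : Set A)

/-- An Ulrich ideal `I` of a (Cohen–Macaulay) local ring `(A, 𝔪)`: `I` is `𝔪`-primary, contains a
parameter ideal `Q` with `I ≠ Q` and `I² = QI` (so that `Q` is a reduction of `I`), and `I/I²` is a
free `A/I`-module. -/
def IsUlrichIdeal {A : Type*} [CommRing A] [IsLocalRing A] (I : Ideal A) : Prop :=
  I.radical = IsLocalRing.maximalIdeal A ∧
    (∃ Q : Ideal A, IsParameterIdeal Q ∧ Q ≤ I ∧ I ≠ Q ∧ I ^ 2 = Q * I) ∧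
    Module.Free (A ⧸ I) I.Cotangent

/-- The set of Ulrich ideals of a local ring. -/
def ulrichIdeals (A : Type*) [CommRing A] [IsLocalRing A] : Set (Ideal A) :=
  {I | IsUlrichIdeal I}

/-- The numerical semigroup `⟨5, 6, 9⟩`. -/
def H569 : AddSubmonoid ℕ := AddSubmonoid.closure {5, 6, 9}

theorem six_mem_H569 : 6 ∈ H569 := AddSubmonoid.subset_closure (by simp)

theorem nine_mem_H569 : 9 ∈ H569 := AddSubmonoid.subset_closure (by simp)

theorem ten_mem_H569 : 10 ∈ H569 :=
  H569.add_mem (x := 5) (y := 5) (AddSubmonoid.subset_closure (by simp))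
    (AddSubmonoid.subset_closure (by simp))

/-- The ideal `(t⁶ + α t¹⁰, t⁹ + β t¹⁰)` of `k[[t⁵, t⁶, t⁹]]`. -/
noncomputable def ideal569 {k : Type*} [Field k] (α β : k) : Ideal (semigroupRing k H569) :=
  Ideal.span {tPow k 6 six_mem_H569 + α • tPow k 10 ten_mem_H569,
    tPow k 9 nine_mem_H569 + β • tPow k 10 ten_mem_H569}

/-! Write `A` for the ring. Suppose `I² = aI` and `I/I²` is free. An element of least order in `I`
shows that `a` itself has least order, so `I = aJ` with `J ⊆ k⟦X⟧`, and `J` is closed under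
multiplication. Since `I ≠ (a)`, some element of `J` has a nonzero coefficient at a gap of `H`. Take
the least such gap `s`, and remove from that element its part supported on `H` to get `y`. Then `a`
and `ay` are independent modulo `𝔪I`. For `c ∈ I`, `I² = aI` gives `cy ∈ I ⊆ A`. Conversely, if `cy
∈ A`, the relation `c·(ay) = (cy)·a` and freeness force `c ∈ I`
(`mem_of_mul_eq_mul_of_free_cotangent`). Hence `I = A : y` (`exists_mem_iff_mul_mem`), which is
given by finitely many linear conditions on coefficients (`mul_mem_semigroupRing_H569_iff`).

There are seven gaps, so seven cases for `s = ord y`. The conditions produce elements of `I` of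
small order, and `ord x + ord z - ord a` must lie in `H` for `x, z ∈ I`. Together with the
conditions on `a` itself, this excludes every `s` except `3`. For `s = 3` the conditions are exactly
those of `mem_ideal569_iff`, and the coefficient of `t¹⁹` in `(t⁹ + βt¹⁰)² ∈ aI` gives `2β = 0`.

Conversely, let `h = (t⁹ + βt¹⁰)/(t⁶ + αt¹⁰)`. The only obstruction to `(t⁹ + βt¹⁰)h ∈ A` is its
`t¹³` coefficient `2β`. When it vanishes, `I² = (t⁶ + αt¹⁰)I`, and `A : h = I` yields freeness.
Uniqueness of `α, β` can be read off the linear conditions. -/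

/-! ### Free conormal modules over a local ring -/

section General

variable {A : Type*} [CommRing A] [IsLocalRing A]

/-- If `I/I²` is free and `x, y ∈ I` are part of a minimal system of generators of `I`, then the
coefficients of a relation `c * y = d * x` lie in `I`. -/
theorem mem_of_mul_eq_mul_of_free_cotangent {I : Ideal A} [Module.Free (A ⧸ I) I.Cotangent]
    (hI : I ≤ IsLocalRing.maximalIdeal A) {x y c d : A} (hx : x ∈ I) (hy : y ∈ I)
    (hx' : x ∉ IsLocalRing.maximalIdeal A * I)
    (hxy : ∀ u, y - u * x ∉ IsLocalRing.maximalIdeal A * I)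
    (h : c * y = d * x) : c ∈ I := by
  classical
  let b := Module.Free.chooseBasis (A ⧸ I) I.Cotangent
  -- Outside `𝔪I` some coordinate is a unit: otherwise all coordinates lift into `𝔪`, and `I² ⊆ 𝔪I`
  -- would put `z` in `𝔪I`.
  have key : ∀ z : I, (z : A) ∉ IsLocalRing.maximalIdeal A * I →
      ∃ j r, IsUnit r ∧ b.repr (I.toCotangent z) j = Ideal.Quotient.mk I r := by
    intro z hz
    by_contra! hcon
    apply hz
    have hm : ∀ w : I.Cotangent, ∃ v : I, I.toCotangent v = w := I.toCotangent_surjective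
    choose v hv using hm
    have hr : ∀ j, ∃ r, Ideal.Quotient.mk I r = b.repr (I.toCotangent z) j :=
      fun j => Ideal.Quotient.mk_surjective _
    choose r hr using hr
    have hsum : I.toCotangent z =
        I.toCotangent (∑ j ∈ (b.repr (I.toCotangent z)).support, r j • v (b j)) := by
      conv_lhs => rw [← b.linearCombination_repr (I.toCotangent z), Finsupp.linearCombination_apply,
        Finsupp.sum]
      rw [map_sum]
      refine Finset.sum_congr rfl fun j _ => ?_
      rw [map_smul, hv, ← hr j]
      rfl
    rw [Ideal.toCotangent_eq] at hsum
    have h1 : I ^ 2 ≤ IsLocalRing.maximalIdeal A * I := by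
      rw [pow_two]; exact Ideal.mul_mono_left hI
    have h2 : ((∑ j ∈ (b.repr (I.toCotangent z)).support, r j • v (b j) : I) : A) ∈
        IsLocalRing.maximalIdeal A * I := by
      rw [AddSubmonoidClass.coe_finsetSum]
      refine Ideal.sum_mem _ fun j _ => ?_
      refine Ideal.mul_mem_mul ?_ (v (b j)).2
      rw [IsLocalRing.mem_maximalIdeal]
      exact fun hu => hcon j (r j) hu (hr j).symm
    have := add_mem (h1 hsum) h2
    simpa using this
  have hsm : ∀ (p : A) (z : I.Cotangent), p • z = Ideal.Quotient.mk I p • z := fun _ _ => rfl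
  obtain ⟨j, r, hru, hr⟩ := key ⟨x, hx⟩ hx'
  obtain ⟨q, hq⟩ := Ideal.Quotient.mk_surjective (b.repr (I.toCotangent ⟨y, hy⟩) j)
  obtain ⟨r', hr'⟩ := hru.exists_left_inv
  -- Clear the `j`-th coordinate of `y` using the unit coordinate `r` of `x`. The difference still
  -- has a unit coordinate `s`. The relation in coordinate `j` gives `d ≡ c r' q`, so in coordinate
  -- `i` it becomes `c s ≡ 0` modulo `I`.
  obtain ⟨i, s, hsu, hs⟩ := key (⟨y, hy⟩ - (r' * q) • ⟨x, hx⟩) (by simpa using hxy (r' * q))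
  have hrel : c • I.toCotangent ⟨y, hy⟩ = d • I.toCotangent ⟨x, hx⟩ := by
    rw [← map_smul, ← map_smul]
    congr 1
    exact Subtype.ext h
  have hco : ∀ l, Ideal.Quotient.mk I c * b.repr (I.toCotangent ⟨y, hy⟩) l =
      Ideal.Quotient.mk I d * b.repr (I.toCotangent ⟨x, hx⟩) l := by
    intro l
    have := congrArg (fun z => b.repr z l) hrel
    simpa [hsm] using this
  have hi := hco i
  have hj := hco j
  rw [map_sub, map_smul, hsm] at hs
  simp only [map_sub, map_smul, Finsupp.sub_apply, Finsupp.smul_apply, smul_eq_mul] at hs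
  have hd : Ideal.Quotient.mk I d = Ideal.Quotient.mk I (c * r' * q) := by
    rw [← hq, hr] at hj
    have h1 : Ideal.Quotient.mk I r' * Ideal.Quotient.mk I r = 1 := by
      rw [← map_mul, hr', map_one]
    simp only [map_mul]
    linear_combination (-Ideal.Quotient.mk I d) * h1 - Ideal.Quotient.mk I r' * hj
  have h0 : Ideal.Quotient.mk I (c * s) = 0 := by
    rw [map_mul, ← hs, mul_sub, hi, hd]
    simp only [map_mul]
    ring
  rw [Ideal.Quotient.eq_zero_iff_mem] at h0
  exact (Ideal.mul_unit_mem_iff_mem I hsu).1 h0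

/-- A criterion for `I/I²` to be free of rank two when `I = (x, y)`. -/
theorem free_cotangent_of_span_pair {A : Type*} [CommRing A] {I : Ideal A} {x y : A}
    (hI : I = Ideal.span {x, y})
    (h : ∀ p q, p * x + q * y ∈ I ^ 2 → p ∈ I ∧ q ∈ I) :
    Module.Free (A ⧸ I) I.Cotangent := by
  have hx : x ∈ I := hI ▸ Ideal.subset_span (by simp)
  have hy : y ∈ I := hI ▸ Ideal.subset_span (by simp)
  have hsm : ∀ (p : A) (z : I.Cotangent), Ideal.Quotient.mk I p • z = p • z := fun _ _ => rfl
  let v : Fin 2 → I.Cotangent := ![I.toCotangent ⟨x, hx⟩, I.toCotangent ⟨y, hy⟩]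
  have hli : LinearIndependent (A ⧸ I) v := by
    rw [LinearIndependent.pair_iff]
    intro p q hpq
    obtain ⟨p, rfl⟩ := Ideal.Quotient.mk_surjective p
    obtain ⟨q, rfl⟩ := Ideal.Quotient.mk_surjective q
    rw [hsm, hsm, ← map_smul, ← map_smul, ← map_add, Ideal.toCotangent_eq_zero] at hpq
    rw [Ideal.Quotient.eq_zero_iff_mem, Ideal.Quotient.eq_zero_iff_mem]
    exact h p q (by simpa using hpq)
  refine Module.Free.of_basis (Module.Basis.mk hli ?_)
  rintro z -
  obtain ⟨⟨z, hz⟩, rfl⟩ := I.toCotangent_surjective z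
  have hz' := hz
  rw [hI, Ideal.mem_span_pair] at hz'
  obtain ⟨p, q, rfl⟩ := hz'
  have : I.toCotangent ⟨p * x + q * y, hz⟩ =
      Ideal.Quotient.mk I p • v 0 + Ideal.Quotient.mk I q • v 1 := by
    rw [hsm, hsm]
    change _ = p • I.toCotangent ⟨x, hx⟩ + q • I.toCotangent ⟨y, hy⟩
    rw [← map_smul, ← map_smul, ← map_add]
    rfl
  rw [this]
  exact add_mem (Submodule.smul_mem _ _ (Submodule.subset_span ⟨0, rfl⟩))
    (Submodule.smul_mem _ _ (Submodule.subset_span ⟨1, rfl⟩))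

end General

/-! ### Products and divisibility in `k⟦X⟧` -/

namespace PowerSeries

theorem coeff_mul_eq_sum_range {R : Type*} [CommSemiring R] (n : ℕ) (f g : R⟦X⟧) :
    coeff n (f * g) = ∑ i ∈ Finset.range (n + 1), coeff i f * coeff (n - i) g := by
  rw [coeff_mul, Finset.Nat.sum_antidiagonal_eq_sum_range_succ_mk]

theorem dvd_of_order_le {k : Type*} [Field k] {f g : k⟦X⟧} (hf : f ≠ 0)
    (h : f.order ≤ g.order) : f ∣ g := by
  by_cases hg : g = 0
  · simp [hg]
  have h1 : f.order.toNat ≤ g.order.toNat :=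
    ENat.toNat_le_toNat h (by rwa [Ne, order_eq_top])
  rw [← X_pow_order_mul_divXPowOrder (f := f), ← X_pow_order_mul_divXPowOrder (f := g)]
  exact mul_dvd_mul (pow_dvd_pow _ h1) (isUnit_divided_by_X_pow_order hf).dvd

end PowerSeries

/-! ### The semigroup `⟨5, 6, 9⟩`, its ring, and parameter ideals -/

section Ring569

theorem mem_H569_iff {n : ℕ} : n ∈ H569 ↔
    n ≠ 1 ∧ n ≠ 2 ∧ n ≠ 3 ∧ n ≠ 4 ∧ n ≠ 7 ∧ n ≠ 8 ∧ n ≠ 13 := by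
  constructor
  · intro h
    induction h using AddSubmonoid.closure_induction with
    | mem x hx =>
      simp only [Set.mem_insert_iff, Set.mem_singleton_iff] at hx
      omega
    | zero => omega
    | add x y _ _ hx hy => omega
  · intro h
    have h5 : 5 ∈ H569 := AddSubmonoid.subset_closure (by simp)
    -- The least elements of `H` in the residue classes `0, 1, 2, 3, 4` modulo `5` are `0, 6, 12,
    -- 18, 9`.
    obtain ⟨a, b, c, rfl⟩ : ∃ a b c, n = a * 5 + b * 6 + c * 9 := by
      have h1 : n % 5 < 5 := Nat.mod_lt _ (by norm_num)
      obtain h2 | h2 | h2 | h2 | h2 :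
        n % 5 = 0 ∨ n % 5 = 1 ∨ n % 5 = 2 ∨ n % 5 = 3 ∨ n % 5 = 4 := by omega
      · exact ⟨n / 5, 0, 0, by omega⟩
      · exact ⟨(n - 6) / 5, 1, 0, by omega⟩
      · exact ⟨(n - 12) / 5, 2, 0, by omega⟩
      · exact ⟨(n - 18) / 5, 0, 2, by omega⟩
      · exact ⟨(n - 9) / 5, 0, 1, by omega⟩
    simp only [← smul_eq_mul]
    exact add_mem (add_mem (nsmul_mem h5 a) (nsmul_mem six_mem_H569 b))
      (nsmul_mem nine_mem_H569 c)

variable {k : Type*} [Field k]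

theorem mem_semigroupRing_H569_iff {f : k⟦X⟧} : f ∈ semigroupRing k H569 ↔
    coeff 1 f = 0 ∧ coeff 2 f = 0 ∧ coeff 3 f = 0 ∧ coeff 4 f = 0 ∧ coeff 7 f = 0 ∧
      coeff 8 f = 0 ∧ coeff 13 f = 0 := by
  rw [mem_semigroupRing]
  refine ⟨fun h => ?_, ?_⟩
  · refine ⟨h 1 ?_, h 2 ?_, h 3 ?_, h 4 ?_, h 7 ?_, h 8 ?_, h 13 ?_⟩ <;> simp [mem_H569_iff]
  · rintro ⟨h1, h2, h3, h4, h7, h8, h13⟩ n hn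
    rw [mem_H569_iff] at hn
    obtain rfl | rfl | rfl | rfl | rfl | rfl | rfl :
      n = 1 ∨ n = 2 ∨ n = 3 ∨ n = 4 ∨ n = 7 ∨ n = 8 ∨ n = 13 := by omega
    all_goals assumption

theorem mem_maximalIdeal_semigroupRing_iff {H : AddSubmonoid ℕ} {f : semigroupRing k H} :
    f ∈ IsLocalRing.maximalIdeal (semigroupRing k H) ↔ coeff 0 (f : k⟦X⟧) = 0 := by
  rw [IsLocalRing.mem_maximalIdeal, mem_nonunits_iff, coeff_zero_eq_constantCoeff_apply]
  constructor
  · intro h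
    by_contra h0
    exact h (isUnit_semigroupRing_of_constantCoeff_ne_zero f h0)
  · intro h hu
    have := (hu.map (semigroupRing k H).val).map (constantCoeff (R := k))
    exact this.ne_zero h

/-- The largest gap is `13`, so `t¹⁴k⟦X⟧ ⊆ A`. A high power of `y` is divisible in `k⟦X⟧` by
`x·t¹⁴`, hence by `x` in `A`. -/
theorem maximalIdeal_le_radical_span_singleton {x : semigroupRing k H569} (hx : x ≠ 0) :
    IsLocalRing.maximalIdeal (semigroupRing k H569) ≤ (Ideal.span {x}).radical := by
  intro y hy
  rw [mem_maximalIdeal_semigroupRing_iff] at hy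
  have hx0 : (x : k⟦X⟧) ≠ 0 := by simpa using hx
  set N := (x : k⟦X⟧).order.toNat with hN
  have hy1 : X ∣ (y : k⟦X⟧) := X_dvd_iff.2 (by simpa using hy)
  have hdvd : (x : k⟦X⟧) ∣ X ^ N := by
    refine dvd_of_order_le hx0 ?_
    rw [order_X_pow, hN, coe_toNat_order hx0]
  obtain ⟨w, hw⟩ := mul_dvd_mul hdvd (dvd_refl (X ^ 14 : k⟦X⟧))
  obtain ⟨v, hv⟩ := pow_dvd_pow_of_dvd hy1 (N + 14)
  have hyv : (y : k⟦X⟧) ^ (N + 14) = (x : k⟦X⟧) * (X ^ 14 * (w * v)) := by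
    rw [hv, pow_add, hw]; ring
  have hmem : X ^ 14 * (w * v) ∈ semigroupRing k H569 := by
    rw [mem_semigroupRing_H569_iff]
    simp [coeff_X_pow_mul']
  refine ⟨N + 14, Ideal.mem_span_singleton.2 ⟨⟨_, hmem⟩, Subtype.ext ?_⟩⟩
  simpa using hyv

theorem radical_eq_maximalIdeal {I : Ideal (semigroupRing k H569)} {x : semigroupRing k H569}
    (hx : x ≠ 0) (hxI : x ∈ I) (hI : I ≤ IsLocalRing.maximalIdeal _) :
    I.radical = IsLocalRing.maximalIdeal (semigroupRing k H569) := by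
  refine le_antisymm ?_ ?_
  · exact (Ideal.IsPrime.isRadical inferInstance).radical_le_iff.2 hI
  · exact (maximalIdeal_le_radical_span_singleton hx).trans
      (Ideal.radical_mono ((Ideal.span_singleton_le_iff_mem _).2 hxI))

theorem tPow_ne_zero {H : AddSubmonoid ℕ} (n : ℕ) (hn : n ∈ H) : tPow k n hn ≠ 0 := by
  intro h
  have : (X ^ n : k⟦X⟧) = 0 := congrArg Subtype.val h
  exact pow_ne_zero n X_ne_zero this

theorem maximalIdeal_ne_bot : IsLocalRing.maximalIdeal (semigroupRing k H569) ≠ ⊥ := by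
  intro h
  have h6 : tPow k 6 six_mem_H569 ∈ IsLocalRing.maximalIdeal (semigroupRing k H569) := by
    rw [mem_maximalIdeal_semigroupRing_iff]
    simp [tPow, coeff_X_pow]
  rw [h, Ideal.mem_bot] at h6
  exact tPow_ne_zero _ _ h6

theorem ringKrullDim_semigroupRing_H569 : ringKrullDim (semigroupRing k H569) = 1 := by
  rw [ringKrullDim_eq_one_iff_of_isLocalRing_isDomain]
  refine ⟨fun h => ?_, fun x hx => maximalIdeal_le_radical_span_singleton hx⟩
  exact maximalIdeal_ne_bot (IsLocalRing.isField_iff_maximalIdeal_eq.1 h)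

theorem isParameterIdeal_span_singleton {x : semigroupRing k H569} (hx : x ≠ 0)
    (hxm : x ∈ IsLocalRing.maximalIdeal (semigroupRing k H569)) :
    IsParameterIdeal (Ideal.span {x}) := by
  refine ⟨radical_eq_maximalIdeal hx (Ideal.mem_span_singleton_self x)
    ((Ideal.span_singleton_le_iff_mem _).2 hxm), {x}, ?_, by simp⟩
  rw [ringKrullDim_semigroupRing_H569]
  simp

theorem exists_eq_span_singleton_of_isParameterIdeal {Q : Ideal (semigroupRing k H569)}
    (hQ : IsParameterIdeal Q) : ∃ a, a ≠ 0 ∧ Q = Ideal.span {a} := by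
  obtain ⟨hr, s, hs, rfl⟩ := hQ
  rw [ringKrullDim_semigroupRing_H569] at hs
  have hs1 : s.card = 1 := by exact_mod_cast hs
  obtain ⟨a, rfl⟩ := Finset.card_eq_one.1 hs1
  refine ⟨a, ?_, by simp⟩
  rintro rfl
  apply maximalIdeal_ne_bot (k := k)
  rw [← hr]
  simp

end Ring569

/-! ### The ideals `(t⁶ + αt¹⁰, t⁹ + βt¹⁰)` are Ulrich when `2β = 0` -/

section Ideal569

variable {k : Type*} [Field k]

/-- The generator `t⁶ + α t¹⁰` of `ideal569 α β`. -/
noncomputable def gen6 (α : k) : semigroupRing k H569 :=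
  tPow k 6 six_mem_H569 + α • tPow k 10 ten_mem_H569

/-- The generator `t⁹ + β t¹⁰` of `ideal569 α β`. -/
noncomputable def gen9 (β : k) : semigroupRing k H569 :=
  tPow k 9 nine_mem_H569 + β • tPow k 10 ten_mem_H569

theorem ideal569_eq_span (α β : k) : ideal569 α β = Ideal.span {gen6 α, gen9 β} := rfl

theorem coe_gen6 (α : k) : (gen6 α : k⟦X⟧) = X ^ 6 + α • X ^ 10 := rfl

theorem coe_gen9 (β : k) : (gen9 β : k⟦X⟧) = X ^ 9 + β • X ^ 10 := rfl

theorem order_gen6 (α : k) : (gen6 α : k⟦X⟧).order = 6 := by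
  refine (order_eq_nat (n := 6)).2 ⟨?_, fun i hi => ?_⟩
  · simp [coe_gen6, coeff_X_pow]
  · have h1 : i ≠ 6 := by omega
    have h2 : i ≠ 10 := by omega
    simp [coe_gen6, coeff_X_pow, h1, h2]

theorem coe_gen6_ne_zero (α : k) : (gen6 α : k⟦X⟧) ≠ 0 := by
  intro h
  have := order_gen6 α
  rw [h, order_zero] at this
  exact absurd this (by simp)

theorem gen6_ne_zero (α : k) : gen6 α ≠ 0 := by
  intro h
  exact coe_gen6_ne_zero α (congrArg Subtype.val h)

theorem coeff_gen6_mul (α : k) (w : k⟦X⟧) (n : ℕ) :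
    coeff (n + 6) (gen6 α * w : k⟦X⟧) = coeff n w + if 4 ≤ n then α * coeff (n - 4) w else 0 := by
  have : (gen6 α * w : k⟦X⟧) = X ^ 6 * (w + α • (X ^ 4 * w)) := by
    rw [coe_gen6, add_mul, mul_add, mul_smul_comm, ← mul_assoc, ← pow_add, smul_mul_assoc]
  rw [this, coeff_X_pow_mul, map_add, coeff_smul, coeff_X_pow_mul']
  split_ifs <;> simp

theorem gen6_dvd_of_coeff_eq_zero (α : k) {f : k⟦X⟧} (hf : ∀ i < 6, coeff i f = 0) :
    ∃ w : k⟦X⟧, f = gen6 α * w :=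
  dvd_of_order_le (coe_gen6_ne_zero α) (by rw [order_gen6]; exact nat_le_order _ _ hf)

/-- The quotient `(t⁹ + β t¹⁰) / (t⁶ + α t¹⁰)` in `k[[t]]`. -/
theorem exists_gen9_eq_gen6_mul (α β : k) : ∃ h : k⟦X⟧, (gen9 β : k⟦X⟧) = gen6 α * h ∧
    coeff 0 h = 0 ∧ coeff 1 h = 0 ∧ coeff 2 h = 0 ∧ coeff 3 h = 1 ∧ coeff 4 h = β ∧
    coeff 5 h = 0 ∧ coeff 6 h = 0 ∧ coeff 7 h = -α := by
  obtain ⟨h, hh⟩ := gen6_dvd_of_coeff_eq_zero α (f := gen9 β) (by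
    intro i hi
    have h1 : i ≠ 9 := by omega
    have h2 : i ≠ 10 := by omega
    simp [coe_gen9, coeff_X_pow, h1, h2])
  have key : ∀ n, coeff (n + 6) (gen9 β : k⟦X⟧) =
      coeff n h + if 4 ≤ n then α * coeff (n - 4) h else 0 := fun n => by
    rw [hh, coeff_gen6_mul]
  have h0 := key 0
  have h1 := key 1
  have h2 := key 2
  have h3 := key 3
  have h4 := key 4
  have h5 := key 5
  have h6 := key 6
  have h7 := key 7
  simp [coe_gen9, coeff_X_pow] at h0 h1 h2 h3
  simp [coe_gen9, coeff_X_pow, ← h0, ← h1, ← h2, ← h3] at h4 h5 h6 h7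
  exact ⟨h, hh, by simpa using h0.symm, h1.symm, h2.symm, h3.symm, h4.symm, h5.symm, h6.symm,
    by linear_combination -h7⟩

/-- Divide by the first generator in `k⟦X⟧`, giving `w`, and look for `q ∈ A` with `w - qh ∈ A`. As
`h` starts at `t³`, the terms `1, t⁵, t¹⁰` of `q` can be chosen successively to cancel the gaps `3,
8, 13`. Gaps `1, 2, 7` vanish because `c` has no `t⁷, t⁸, t¹³` term, and gap `4` is the condition on
the `t¹⁰` coefficient. -/
theorem mem_ideal569_of_coeff {α β : k} {c : semigroupRing k H569}
    (h0 : coeff 0 (c : k⟦X⟧) = 0) (h5 : coeff 5 (c : k⟦X⟧) = 0)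
    (h10 : coeff 10 (c : k⟦X⟧) = α * coeff 6 (c : k⟦X⟧) + β * coeff 9 (c : k⟦X⟧)) :
    c ∈ ideal569 α β := by
  obtain ⟨c1, c2, c3, c4, c7, c8, c13⟩ := mem_semigroupRing_H569_iff.1 c.2
  obtain ⟨w, hw⟩ := gen6_dvd_of_coeff_eq_zero α (f := c) (by
    intro i hi
    interval_cases i <;> assumption)
  obtain ⟨h, hh, g0, g1, g2, g3, g4, g5, g6, g7⟩ := exists_gen9_eq_gen6_mul α β
  have key : ∀ n, coeff (n + 6) (c : k⟦X⟧) =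
      coeff n w + if 4 ≤ n then α * coeff (n - 4) w else 0 := fun n => by
    rw [hw, coeff_gen6_mul]
  have w0 := key 0
  have w1 := key 1
  have w2 := key 2
  have w3 := key 3
  have w4 := key 4
  have w7 := key 7
  norm_num at w0 w1 w2 w3 w4 w7
  set a := coeff 3 w
  set b := coeff 8 w - a * coeff 8 h with hb
  set d := coeff 13 w - a * coeff 13 h - b * coeff 8 h with hd
  have hq : C a + b • X ^ 5 + d • X ^ 10 ∈ semigroupRing k H569 := by
    rw [mem_semigroupRing_H569_iff]
    simp [coeff_X_pow]
  have hqc : ∀ n, coeff n ((C a + b • X ^ 5 + d • X ^ 10) * h) = a * coeff n h +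
      (if 5 ≤ n then b * coeff (n - 5) h else 0) +
      if 10 ≤ n then d * coeff (n - 10) h else 0 := by
    intro n
    rw [add_mul, add_mul, smul_mul_assoc, smul_mul_assoc, map_add, map_add, coeff_C_mul,
      coeff_smul, coeff_smul, coeff_X_pow_mul', coeff_X_pow_mul']
    split_ifs <;> simp
  have hp : w - (C a + b • X ^ 5 + d • X ^ 10) * h ∈ semigroupRing k H569 := by
    rw [mem_semigroupRing_H569_iff]
    simp only [map_sub, hqc]
    norm_num [g0, g1, g2, g3, g4, g5, g6, g7]
    rw [c7] at w1
    rw [c8] at w2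
    rw [c13] at w7
    refine ⟨w1.symm, w2.symm, sub_self _, ?_, ?_, ?_, ?_⟩
    · linear_combination h10 - w4 + α * w0 + β * w3
    · linear_combination -w7
    · rw [hb]; ring
    · rw [hd]; ring
  rw [ideal569_eq_span, Ideal.mem_span_pair]
  refine ⟨⟨_, hp⟩, ⟨_, hq⟩, Subtype.ext ?_⟩
  change (w - (C a + b • X ^ 5 + d • X ^ 10) * h) * (gen6 α : k⟦X⟧) +
    (C a + b • X ^ 5 + d • X ^ 10) * (gen9 β : k⟦X⟧) = (c : k⟦X⟧)
  rw [hh, hw]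
  ring

theorem mem_ideal569_iff {α β : k} {c : semigroupRing k H569} : c ∈ ideal569 α β ↔
    coeff 0 (c : k⟦X⟧) = 0 ∧ coeff 5 (c : k⟦X⟧) = 0 ∧
      coeff 10 (c : k⟦X⟧) = α * coeff 6 (c : k⟦X⟧) + β * coeff 9 (c : k⟦X⟧) := by
  refine ⟨fun hc => ?_, fun h => mem_ideal569_of_coeff h.1 h.2.1 h.2.2⟩
  rw [ideal569_eq_span, Ideal.mem_span_pair] at hc
  obtain ⟨p, q, rfl⟩ := hc
  obtain ⟨p1, p2, p3, p4, p7, p8, p13⟩ := mem_semigroupRing_H569_iff.1 p.2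
  obtain ⟨q1, q2, q3, q4, q7, q8, q13⟩ := mem_semigroupRing_H569_iff.1 q.2
  have : ((p * gen6 α + q * gen9 β : semigroupRing k H569) : k⟦X⟧) =
      X ^ 6 * (p : k⟦X⟧) + α • (X ^ 10 * (p : k⟦X⟧)) +
        (X ^ 9 * (q : k⟦X⟧) + β • (X ^ 10 * (q : k⟦X⟧))) := by
    change (p : k⟦X⟧) * gen6 α + (q : k⟦X⟧) * gen9 β = _
    rw [coe_gen6, coe_gen9, smul_eq_C_mul, smul_eq_C_mul, smul_eq_C_mul, smul_eq_C_mul]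
    ring
  rw [this]
  simp [coeff_X_pow_mul', p3, p4, q1, -coeff_zero_eq_constantCoeff]

theorem gen6_mem (α β : k) : gen6 α ∈ ideal569 α β := Ideal.subset_span (by simp [gen6])

theorem gen9_mem (α β : k) : gen9 β ∈ ideal569 α β := Ideal.subset_span (by simp [gen9])

theorem ideal569_injective {α β α' β' : k} (h : ideal569 α β = ideal569 α' β') :
    α = α' ∧ β = β' := by
  have h6 := gen6_mem α β
  have h9 := gen9_mem α β
  rw [h, mem_ideal569_iff] at h6 h9
  simpa [coe_gen6, coe_gen9, coeff_X_pow] using And.intro h6 h9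

theorem isUlrichIdeal_ideal569 {α β : k} (hβ : 2 * β = 0) : IsUlrichIdeal (ideal569 α β) := by
  have hle : ideal569 α β ≤ IsLocalRing.maximalIdeal (semigroupRing k H569) := fun c hc =>
    mem_maximalIdeal_semigroupRing_iff.2 (mem_ideal569_iff.1 hc).1
  obtain ⟨h, hh, g0, g1, g2, g3, g4, g5, g6, g7⟩ := exists_gen9_eq_gen6_mul α β
  have hgh : ∀ n, coeff (n + 9) (gen9 β * h : k⟦X⟧) =
      coeff n h + if 1 ≤ n then β * coeff (n - 1) h else 0 := by
    intro n
    have : (gen9 β * h : k⟦X⟧) = X ^ 9 * (h + β • (X ^ 1 * h)) := by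
      rw [coe_gen9, smul_eq_C_mul, smul_eq_C_mul]; ring
    rw [this, coeff_X_pow_mul, map_add, coeff_smul, coeff_X_pow_mul']
    split_ifs <;> simp
  have hlow : ∀ i < 9, coeff i (gen9 β * h : k⟦X⟧) = 0 := by
    intro i hi
    have : (gen9 β * h : k⟦X⟧) = X ^ 9 * (h + β • (X ^ 1 * h)) := by
      rw [coe_gen9, smul_eq_C_mul, smul_eq_C_mul]; ring
    rw [this, coeff_X_pow_mul', if_neg (by omega)]
  -- The product has order `12`, so `13` is the only gap to check; the coefficient there is `2β`.
  have hgm : (gen9 β * h : k⟦X⟧) ∈ semigroupRing k H569 := by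
    rw [mem_semigroupRing_H569_iff]
    refine ⟨hlow _ (by norm_num), hlow _ (by norm_num), hlow _ (by norm_num),
      hlow _ (by norm_num), hlow _ (by norm_num), hlow _ (by norm_num), ?_⟩
    rw [hgh 4]
    norm_num [g3, g4]
    linear_combination hβ
  have hgI : (⟨_, hgm⟩ : semigroupRing k H569) ∈ ideal569 α β := by
    rw [mem_ideal569_iff]
    refine ⟨hlow _ (by norm_num), hlow _ (by norm_num), ?_⟩
    change coeff 10 (gen9 β * h : k⟦X⟧) =
      α * coeff 6 (gen9 β * h : k⟦X⟧) + β * coeff 9 (gen9 β * h : k⟦X⟧)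
    rw [hgh 1, hlow 6 (by norm_num), hgh 0]
    norm_num [g0, g1]
  have hgg : gen9 β * gen9 β = gen6 α * ⟨_, hgm⟩ := by
    refine Subtype.ext ?_
    change (gen9 β : k⟦X⟧) * gen9 β = gen6 α * (gen9 β * h)
    conv_lhs => rw [hh]
    rw [hh]; ring
  have hsq : ideal569 α β ^ 2 = Ideal.span {gen6 α} * ideal569 α β := by
    refine le_antisymm ?_ ?_
    · rw [pow_two]
      nth_rewrite 1 [ideal569_eq_span]
      nth_rewrite 1 [ideal569_eq_span]
      rw [Ideal.span_mul_span', Ideal.span_le]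
      rintro _ ⟨x, hx, y, hy, rfl⟩
      simp only [Set.mem_insert_iff, Set.mem_singleton_iff] at hx hy
      rw [SetLike.mem_coe, Ideal.mem_span_singleton_mul]
      rcases hx with rfl | rfl <;> rcases hy with rfl | rfl
      · exact ⟨_, gen6_mem α β, rfl⟩
      · exact ⟨_, gen9_mem α β, rfl⟩
      · exact ⟨_, gen9_mem α β, mul_comm _ _⟩
      · exact ⟨_, hgI, hgg.symm⟩
    · rw [pow_two]
      exact Ideal.mul_mono_left ((Ideal.span_singleton_le_iff_mem _).2 (gen6_mem α β))
  refine ⟨radical_eq_maximalIdeal (gen6_ne_zero α) (gen6_mem α β) hle, ⟨Ideal.span {gen6 α},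
    isParameterIdeal_span_singleton (gen6_ne_zero α) (hle (gen6_mem α β)),
    (Ideal.span_singleton_le_iff_mem _).2 (gen6_mem α β), fun he => ?_, hsq⟩, ?_⟩
  · have h9 := gen9_mem α β
    rw [he, Ideal.mem_span_singleton] at h9
    obtain ⟨v, hv⟩ := h9
    have hv' : (gen6 α * h : k⟦X⟧) = gen6 α * (v : k⟦X⟧) := by
      rw [← hh, hv]; rfl
    have hv3 := v.2
    rw [← mul_left_cancel₀ (coe_gen6_ne_zero α) hv', mem_semigroupRing_H569_iff, g3] at hv3
    exact one_ne_zero hv3.2.2.1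
  -- Dividing `p·gen6 + q·gen9 ∈ gen6·I` by `gen6` gives `p + qh ∈ I`, so `qh ∈ A`. Gaps `3, 8, 13`
  -- of `qh` then yield the conditions for `q ∈ I`; the sign of `β` in the last one is wrong, which
  -- `2β = 0` repairs.
  · refine free_cotangent_of_span_pair (ideal569_eq_span α β) fun p q hpq => ?_
    rw [hsq, Ideal.mem_span_singleton_mul] at hpq
    obtain ⟨i, hi, hpq⟩ := hpq
    have hpq' : (gen6 α * i : k⟦X⟧) = p * gen6 α + q * gen9 β := congrArg Subtype.val hpq
    have hi' : (i : k⟦X⟧) = p + q * h := by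
      refine mul_left_cancel₀ (coe_gen6_ne_zero α) ?_
      rw [hpq', hh]; ring
    have hqh : (q * h : k⟦X⟧) ∈ semigroupRing k H569 := by
      have : (q * h : k⟦X⟧) = i - p := by rw [hi']; ring
      rw [this]; exact sub_mem i.2 p.2
    obtain ⟨q1, q2, q3, q4, q7, q8, q13⟩ := mem_semigroupRing_H569_iff.1 q.2
    have e := mem_semigroupRing_H569_iff.1 hqh
    simp only [coeff_mul_eq_sum_range, Finset.sum_range_succ, Finset.sum_range_zero] at e
    norm_num [g0, g1, g2, g3, g4, g5, g6, g7, q1, q2, q3, q4, q7, q8, q13,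
      -coeff_zero_eq_constantCoeff] at e
    obtain ⟨e3, -, -, e8, e13⟩ := e
    rw [e3] at e8 e13
    norm_num at e8
    rw [e8] at e13
    have hqI : q ∈ ideal569 α β := by
      refine mem_ideal569_iff.2 ⟨e3, e8, ?_⟩
      linear_combination e13 - coeff 9 (q : k⟦X⟧) * hβ
    refine ⟨?_, hqI⟩
    -- Multiplication by `h` sends `gen6` to `gen9` and `gen9` to `gen9·h ∈ I`, so it preserves `I`.
    have hqhI : (⟨_, hqh⟩ : semigroupRing k H569) ∈ ideal569 α β := by
      have hq' := hqI
      rw [ideal569_eq_span, Ideal.mem_span_pair] at hq'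
      obtain ⟨c, d, hcd⟩ := hq'
      have : (⟨_, hqh⟩ : semigroupRing k H569) = c * gen9 β + d * ⟨_, hgm⟩ := by
        refine Subtype.ext ?_
        change (q : k⟦X⟧) * h = c * gen9 β + d * (gen9 β * h)
        have hq2 : (q : k⟦X⟧) = c * gen6 α + d * gen9 β := (congrArg Subtype.val hcd).symm
        rw [hq2]
        linear_combination (-(c : k⟦X⟧)) * hh
      rw [this]
      exact add_mem (Ideal.mul_mem_left _ _ (gen9_mem α β)) (Ideal.mul_mem_left _ _ hgI)
    have : p = i - ⟨_, hqh⟩ := by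
      refine Subtype.ext ?_
      change (p : k⟦X⟧) = i - q * h
      rw [hi']; ring
    rw [this]
    exact sub_mem hi hqhI

end Ideal569

/-! ### Every Ulrich ideal has this form -/

section Classification

variable {k : Type*} [Field k] {I : Ideal (semigroupRing k H569)} {a : semigroupRing k H569}

theorem exists_mul_eq_mul_of_sq_eq (h2 : I ^ 2 = Ideal.span {a} * I)
    {x z : semigroupRing k H569} (hx : x ∈ I) (hz : z ∈ I) :
    ∃ i ∈ I, (x * z : k⟦X⟧) = a * i := by
  have : x * z ∈ I ^ 2 := by rw [pow_two]; exact Ideal.mul_mem_mul hx hz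
  rw [h2, Ideal.mem_span_singleton_mul] at this
  obtain ⟨i, hi, h⟩ := this
  exact ⟨i, hi, congrArg Subtype.val h.symm⟩

/-- If `y` has least order in `I` and `y² = ai` with `i ∈ I`, then `2 ord y = ord a + ord i ≥ ord a
+ ord y`. -/
theorem order_le_of_sq_eq (h2 : I ^ 2 = Ideal.span {a} * I) (ha : a ∈ I) (ha0 : a ≠ 0)
    {x : semigroupRing k H569} (hx : x ∈ I) : (a : k⟦X⟧).order ≤ (x : k⟦X⟧).order := by
  obtain ⟨n, ⟨y, hy, rfl⟩, hmin⟩ := exists_minimal_of_wellFoundedLT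
    (fun n : ℕ∞ => ∃ y ∈ I, (y : k⟦X⟧).order = n) ⟨_, x, hx, rfl⟩
  have hle : ∀ z ∈ I, (y : k⟦X⟧).order ≤ (z : k⟦X⟧).order := fun z hz =>
    (le_total _ _).elim id (fun h => hmin ⟨z, hz, rfl⟩ h)
  refine le_trans ?_ (hle x hx)
  obtain ⟨i, hi, hyi⟩ := exists_mul_eq_mul_of_sq_eq h2 hy hy
  have ho := congrArg order hyi
  rw [order_mul, order_mul] at ho
  have hfin : (y : k⟦X⟧).order ≠ ⊤ := by
    refine ne_top_of_le_ne_top ?_ (hle a ha)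
    rw [Ne, order_eq_top]
    simpa using ha0
  refine (ENat.add_le_add_iff_right hfin).1 ?_
  rw [ho]
  exact add_le_add_right (hle i hi) _

/-- Orders of products in an ideal with `I² = aI` differ from `ord a` by an element of `H`. -/
theorem mem_H569_of_sq_eq (h2 : I ^ 2 = Ideal.span {a} * I) {x z : semigroupRing k H569}
    (hx : x ∈ I) (hz : z ∈ I) {n m e d : ℕ} (hn : (x : k⟦X⟧).order = n)
    (hm : (z : k⟦X⟧).order = m) (he : (a : k⟦X⟧).order = e) (hd : n + m = e + d) :
    d ∈ H569 := by
  obtain ⟨i, -, h⟩ := exists_mul_eq_mul_of_sq_eq h2 hx hz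
  have ho := congrArg order h
  rw [order_mul, order_mul, hn, hm, he] at ho
  have hid : (i : k⟦X⟧).order = d := by
    refine ENat.add_right_injective_of_ne_top (ENat.natCast_ne_top e) (ho.symm.trans ?_)
    change ((n : ℕ∞) + m) = e + d
    exact_mod_cast hd
  by_contra hH
  exact (order_eq_nat.1 hid).1 (i.2 d hH)

/-- An ideal with `I² = aI` and free conormal module is the conductor into `k[[H]]` of a single
power series `y` supported on the gaps of `H`. -/
theorem exists_mem_iff_mul_mem (h2 : I ^ 2 = Ideal.span {a} * I) (ha : a ∈ I) (ha0 : a ≠ 0)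
    (hI : I ≤ IsLocalRing.maximalIdeal _) (hne : I ≠ Ideal.span {a})
    (hfree : Module.Free (semigroupRing k H569 ⧸ I) I.Cotangent) :
    ∃ (s : ℕ) (y : k⟦X⟧), s ∉ H569 ∧ coeff s y ≠ 0 ∧ (∀ n ∈ H569, coeff n y = 0) ∧
      (∀ n < s, coeff n y = 0) ∧
      ∀ c : semigroupRing k H569, c ∈ I ↔ (c * y : k⟦X⟧) ∈ semigroupRing k H569 := by
  classical
  have hac : (a : k⟦X⟧) ≠ 0 := by simpa using ha0
  have hdiv : ∀ b ∈ I, ∃ w : k⟦X⟧, (b : k⟦X⟧) = a * w := fun b hb =>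
    dvd_of_order_le hac (order_le_of_sq_eq h2 ha ha0 hb)
  -- If no quotient `b/a` had a nonzero coefficient at a gap, all of them would lie in `A` and `I`
  -- would equal `(a)`.
  have hex : ∃ s, s ∉ H569 ∧ ∃ w : k⟦X⟧, (∃ b ∈ I, (b : k⟦X⟧) = a * w) ∧ coeff s w ≠ 0 := by
    by_contra! hcon
    refine hne (le_antisymm (fun b hb => ?_) ((Ideal.span_singleton_le_iff_mem _).2 ha))
    obtain ⟨w, hw⟩ := hdiv b hb
    exact Ideal.mem_span_singleton.2
      ⟨⟨w, fun n hn => hcon n hn w ⟨b, hb, hw⟩⟩, Subtype.ext hw⟩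
  obtain ⟨hs, w, ⟨b, hb, hbw⟩, hws⟩ := Nat.find_spec hex
  have hmin : ∀ n < Nat.find hex, n ∉ H569 → ∀ w : k⟦X⟧, (∃ b ∈ I, (b : k⟦X⟧) = a * w) →
      coeff n w = 0 := by
    intro n hn hnH w hw
    by_contra hc
    exact Nat.find_min hex hn ⟨hnH, w, hw, hc⟩
  set s := Nat.find hex
  let r : semigroupRing k H569 :=
    ⟨PowerSeries.mk fun n => if n ∈ H569 then coeff n w else 0, fun n hn => by simp [hn]⟩
  have hr : ∀ n, coeff n (r : k⟦X⟧) = if n ∈ H569 then coeff n w else 0 := fun n => by simp [r]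
  set y : k⟦X⟧ := w - r with hy
  have hyI : b - a * r ∈ I := sub_mem hb (Ideal.mul_mem_right _ _ ha)
  have hyc : ((b - a * r : semigroupRing k H569) : k⟦X⟧) = a * y := by
    change (b : k⟦X⟧) - a * r = a * y
    rw [hbw, hy, mul_sub]
  have hys : coeff s y ≠ 0 := by
    rw [hy, map_sub, hr, if_neg hs, sub_zero]
    exact hws
  -- A gap minus an element of `H` is not in `H`, so multiplying by an element of `𝔪` moves only
  -- smaller gaps into position `s`, and these carry zero by minimality of `s`.
  have hmI : ∀ z ∈ IsLocalRing.maximalIdeal (semigroupRing k H569) * I,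
      ∃ v : k⟦X⟧, (z : k⟦X⟧) = a * v ∧ coeff s v = 0 ∧ coeff 0 v = 0 := by
    intro z hz
    induction hz using Submodule.mul_induction_on' with
    | mem_mul_mem m hm b hb =>
      rw [mem_maximalIdeal_semigroupRing_iff] at hm
      obtain ⟨v, hv⟩ := hdiv b hb
      refine ⟨m * v, ?_, ?_, ?_⟩
      · change (m : k⟦X⟧) * b = _
        rw [hv]; ring
      · rw [coeff_mul_eq_sum_range]
        refine Finset.sum_eq_zero fun i hi => ?_
        rw [Finset.mem_range] at hi
        by_cases hi0 : i = 0
        · rw [hi0, hm, zero_mul]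
        by_cases hiH : i ∈ H569
        · have hsi : s - i ∉ H569 := fun h => hs (by
            have := H569.add_mem hiH h
            rwa [Nat.add_sub_cancel' (by omega)] at this)
          rw [hmin (s - i) (by omega) hsi v ⟨b, hb, hv⟩, mul_zero]
        · rw [m.2 i hiH, zero_mul]
      · rw [coeff_mul_eq_sum_range]
        simp only [zero_add, Finset.sum_range_one, hm, zero_mul]
    | add x _ y _ hx hy =>
      obtain ⟨v, hv, h1, h3⟩ := hx
      obtain ⟨v', hv', h1', h3'⟩ := hy
      refine ⟨v + v', ?_, by rw [map_add, h1, h1', add_zero], by rw [map_add, h3, h3', add_zero]⟩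
      change (x : k⟦X⟧) + y = _
      rw [hv, hv', mul_add]
  refine ⟨s, y, hs, hys, ?_, ?_, fun c => ⟨fun hc => ?_, fun hc => ?_⟩⟩
  · intro n hn
    rw [hy, map_sub, hr, if_pos hn, sub_self]
  · intro n hn
    by_cases hnH : n ∈ H569
    · rw [hy, map_sub, hr, if_pos hnH, sub_self]
    · rw [hy, map_sub, hr, if_neg hnH, sub_zero]
      exact hmin n hn hnH w ⟨b, hb, hbw⟩
  · obtain ⟨i, hi, h⟩ := exists_mul_eq_mul_of_sq_eq h2 hc hyI
    have : (c * y : k⟦X⟧) = i := by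
      refine mul_left_cancel₀ hac ?_
      rw [← h, hyc]; ring
    rw [this]
    exact i.2
  -- Independence modulo `𝔪I` is detected after dividing by `a`: the series `1` has nonzero constant
  -- coefficient, and `y - u` has nonzero coefficient at the gap `s` for every `u ∈ A`.
  · refine mem_of_mul_eq_mul_of_free_cotangent (d := ⟨_, hc⟩) hI ha hyI ?_ ?_ ?_
    · intro h
      obtain ⟨v, hv, -, hv0⟩ := hmI a h
      have hv1 : v = 1 := mul_left_cancel₀ hac (by rw [← hv, mul_one])
      rw [hv1] at hv0
      simp at hv0
    · intro u h
      obtain ⟨v, hv, hvs, -⟩ := hmI _ h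
      have hv1 : y - u = v := by
        refine mul_left_cancel₀ hac ?_
        rw [← hv]
        change _ = ((b - a * r : semigroupRing k H569) : k⟦X⟧) - u * a
        rw [hyc]; ring
      rw [← hv1, map_sub, u.2 s hs, sub_zero] at hvs
      exact hys hvs
    · refine Subtype.ext ?_
      change (c : k⟦X⟧) * ((b - a * r : semigroupRing k H569) : k⟦X⟧) = c * y * a
      rw [hyc]; ring

/-- As `c` is supported on `H` and `y` on the gaps, the coefficient of `cy` at a gap keeps only
terms indexed by an element of `H` plus a gap. -/
theorem mul_mem_semigroupRing_H569_iff {y : k⟦X⟧} (hy : ∀ n ∈ H569, coeff n y = 0)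
    (c : semigroupRing k H569) : (c * y : k⟦X⟧) ∈ semigroupRing k H569 ↔
      coeff 0 (c : k⟦X⟧) * coeff 1 y = 0 ∧ coeff 0 (c : k⟦X⟧) * coeff 2 y = 0 ∧
      coeff 0 (c : k⟦X⟧) * coeff 3 y = 0 ∧ coeff 0 (c : k⟦X⟧) * coeff 4 y = 0 ∧
      coeff 0 (c : k⟦X⟧) * coeff 7 y + coeff 5 (c : k⟦X⟧) * coeff 2 y +
        coeff 6 (c : k⟦X⟧) * coeff 1 y = 0 ∧
      coeff 0 (c : k⟦X⟧) * coeff 8 y + coeff 5 (c : k⟦X⟧) * coeff 3 y +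
        coeff 6 (c : k⟦X⟧) * coeff 2 y = 0 ∧
      coeff 0 (c : k⟦X⟧) * coeff 13 y + coeff 5 (c : k⟦X⟧) * coeff 8 y +
        coeff 6 (c : k⟦X⟧) * coeff 7 y + coeff 9 (c : k⟦X⟧) * coeff 4 y +
        coeff 10 (c : k⟦X⟧) * coeff 3 y + coeff 11 (c : k⟦X⟧) * coeff 2 y +
        coeff 12 (c : k⟦X⟧) * coeff 1 y = 0 := by
  obtain ⟨c1, c2, c3, c4, c7, c8, c13⟩ := mem_semigroupRing_H569_iff.1 c.2
  have y0 := hy 0 (zero_mem _)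
  have y5 := hy 5 (by simp [mem_H569_iff])
  have y6 := hy 6 (by simp [mem_H569_iff])
  have y9 := hy 9 (by simp [mem_H569_iff])
  have y10 := hy 10 (by simp [mem_H569_iff])
  have y11 := hy 11 (by simp [mem_H569_iff])
  have y12 := hy 12 (by simp [mem_H569_iff])
  rw [mem_semigroupRing_H569_iff]
  simp only [coeff_mul_eq_sum_range, Finset.sum_range_succ, Finset.sum_range_zero, Nat.reduceSub,
    Nat.reduceAdd, c1, c2, c3, c4, c7, c8, c13, y0, y5, y6, y9, y10, y11, y12, mul_zero, zero_mul,
    add_zero, zero_add, tsub_zero, tsub_self]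

/-- The element `tⁿ + μ tᵐ` of `k[[H]]`. -/
noncomputable def binom569 {n m : ℕ} (hn : n ∈ H569) (hm : m ∈ H569) (μ : k) :
    semigroupRing k H569 :=
  tPow k n hn + μ • tPow k m hm

theorem coeff_binom569 {n m : ℕ} (hn : n ∈ H569) (hm : m ∈ H569) (μ : k) (i : ℕ) :
    coeff i (binom569 hn hm μ : k⟦X⟧) = (if i = n then 1 else 0) + μ * if i = m then 1 else 0 := by
  change coeff i (X ^ n + μ • X ^ m : k⟦X⟧) = _
  rw [map_add, coeff_smul, coeff_X_pow, coeff_X_pow, smul_eq_mul]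

theorem order_binom569 {n m : ℕ} (hn : n ∈ H569) (hm : m ∈ H569) (μ : k) (hnm : n < m) :
    (binom569 hn hm μ : k⟦X⟧).order = n := by
  refine order_eq_nat.2 ⟨?_, fun i hi => ?_⟩
  · rw [coeff_binom569, if_pos rfl, if_neg hnm.ne]
    simp
  · rw [coeff_binom569, if_neg hi.ne, if_neg (by omega)]
    simp

/-- Here `ord a = 6`, so `gen9² = ai` with `ord i = 12`. The coefficient of `t¹⁹` on the left is
`2β`; on the right only `a₆i₁₃ + a₇i₁₂` can occur, and `7` and `13` are gaps. -/
theorem two_mul_eq_zero_of_sq_eq {α β : k} (ha0 : a ≠ 0) (ha : a ∈ ideal569 α β)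
    (h2 : ideal569 α β ^ 2 = Ideal.span {a} * ideal569 α β) : 2 * β = 0 := by
  obtain ⟨a0, a5, -⟩ := mem_ideal569_iff.1 ha
  obtain ⟨a1, a2, a3, a4, a7, a8, a13⟩ := mem_semigroupRing_H569_iff.1 a.2
  have hlow : ∀ n < 6, coeff n (a : k⟦X⟧) = 0 := by
    intro n hn
    interval_cases n <;> assumption
  have ho : (a : k⟦X⟧).order = (6 : ℕ) := le_antisymm
    ((order_le_of_sq_eq h2 ha ha0 (gen6_mem α β)).trans (order_gen6 α).le) (nat_le_order _ _ hlow)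
  have ho9 : (gen9 β : k⟦X⟧).order = (9 : ℕ) :=
    order_binom569 nine_mem_H569 ten_mem_H569 β (by norm_num)
  obtain ⟨i, hi, h⟩ := exists_mul_eq_mul_of_sq_eq h2 (gen9_mem α β) (gen9_mem α β)
  have hoi := congrArg order h
  rw [order_mul, order_mul, ho, ho9] at hoi
  have hi12 : (i : k⟦X⟧).order = (12 : ℕ) := by
    refine ENat.add_right_injective_of_ne_top (ENat.natCast_ne_top 6) (hoi.symm.trans ?_)
    norm_num
  have hilow := (order_eq_nat.1 hi12).2
  have i13 := (mem_semigroupRing_H569_iff.1 i.2).2.2.2.2.2.2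
  have hc := congrArg (coeff 19) h
  have hl : coeff 19 (gen9 β * gen9 β : k⟦X⟧) = 2 * β := by
    have : (gen9 β * gen9 β : k⟦X⟧) = X ^ 18 + (2 * β) • X ^ 19 + β ^ 2 • X ^ 20 := by
      rw [coe_gen9]
      simp only [smul_eq_C_mul, map_mul, map_pow, map_ofNat]
      ring
    rw [this]
    simp [coeff_X_pow]
  rw [← hl, hc, coeff_mul_eq_sum_range]
  refine Finset.sum_eq_zero fun j hj => ?_
  by_cases h6 : j < 6
  · rw [hlow j h6, zero_mul]
  by_cases hj6 : j = 6
  · rw [hj6, i13, mul_zero]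
  by_cases hj7 : j = 7
  · rw [hj7, a7, zero_mul]
  · rw [hilow (19 - j) (by omega), mul_zero]

theorem exists_eq_ideal569_of_isUlrichIdeal (hI : IsUlrichIdeal I) :
    ∃ α β : k, 2 * β = 0 ∧ I = ideal569 α β := by
  obtain ⟨hrad, ⟨Q, hQ, hQI, hne, h2⟩, hfree⟩ := hI
  obtain ⟨a, ha0, rfl⟩ := exists_eq_span_singleton_of_isParameterIdeal hQ
  have ha : a ∈ I := hQI (Ideal.mem_span_singleton_self a)
  obtain ⟨s, y, hs, hys, hyH, hylow, hmem⟩ :=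
    exists_mem_iff_mul_mem h2 ha ha0 (hrad ▸ Ideal.le_radical) hne hfree
  simp only [mul_mem_semigroupRing_H569_iff hyH] at hmem
  have m5 : 5 ∈ H569 := by simp [mem_H569_iff]
  have m6 := six_mem_H569
  have m9 := nine_mem_H569
  have m10 := ten_mem_H569
  have m11 : 11 ∈ H569 := by simp [mem_H569_iff]
  have m14 : 14 ∈ H569 := by simp [mem_H569_iff]
  have m12 : 12 ∈ H569 := by simp [mem_H569_iff]
  have hac : (a : k⟦X⟧) ≠ 0 := by simpa using ha0
  obtain ⟨e, he⟩ : ∃ e : ℕ, (a : k⟦X⟧).order = e := ⟨_, (coe_toNat_order hac).symm⟩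
  have hae := (order_eq_nat.1 he).1
  have heH : e ∈ H569 := by
    by_contra h
    exact hae (a.2 e h)
  have hle : ∀ {n m : ℕ} (hn : n ∈ H569) (hm : m ∈ H569) (μ : k), n < m →
      binom569 hn hm μ ∈ I → e ≤ n := by
    intro n m hn hm μ hnm h
    have := order_le_of_sq_eq h2 ha ha0 h
    rw [order_binom569 hn hm μ hnm, he] at this
    exact_mod_cast this
  have hgap : ∀ {n m n' m' : ℕ} (hn : n ∈ H569) (hm : m ∈ H569) (μ : k) (hn' : n' ∈ H569)
      (hm' : m' ∈ H569) (μ' : k) (d : ℕ), n < m → n' < m' → n + n' = e + d →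
      binom569 hn hm μ ∈ I → binom569 hn' hm' μ' ∈ I → d ∈ H569 := by
    intro n m n' m' hn hm μ hn' hm' μ' d hnm hnm' hd h h'
    exact mem_H569_of_sq_eq h2 h h' (order_binom569 _ _ _ hnm) (order_binom569 _ _ _ hnm') he hd
  have e0 := (hmem a).1 ha
  have hcases : s = 1 ∨ s = 2 ∨ s = 3 ∨ s = 4 ∨ s = 7 ∨ s = 8 ∨ s = 13 := by
    rw [mem_H569_iff] at hs
    omega
  have a00 : coeff 0 (a : k⟦X⟧) = 0 :=
    mem_maximalIdeal_semigroupRing_iff.1 ((hrad ▸ Ideal.le_radical : I ≤ _) ha)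
  rw [mem_H569_iff] at heH
  rw [a00] at e0
  have he0 : e ≠ 0 := by
    rintro rfl
    exact hae a00
  have not13 : 13 ∉ H569 := by simp [mem_H569_iff]
  have not7 : 7 ∉ H569 := by simp [mem_H569_iff]
  rcases hcases with rfl | rfl | rfl | rfl | rfl | rfl | rfl
  -- Case `s = 1`. The coefficient `μ` in each binomial is chosen to cancel the gap `13` condition.
  -- The contradictions are `9 + 9 = 5 + 13` and `11 + 11 = 9 + 13`; for `e = 6` the gap `7`
  -- condition on `a` fails.
  · exfalso
    have h9 : binom569 m9 m12 (-(coeff 4 y / coeff 1 y)) ∈ I := (hmem _).2 (by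
      norm_num [coeff_binom569, -coeff_zero_eq_constantCoeff, hys])
    have h11 : binom569 m11 m12 (-(coeff 2 y / coeff 1 y)) ∈ I := (hmem _).2 (by
      norm_num [coeff_binom569, -coeff_zero_eq_constantCoeff, hys])
    have := hle _ _ _ (by norm_num) h9
    obtain rfl | rfl | rfl : e = 5 ∨ e = 6 ∨ e = 9 := by omega
    · exact not13 (hgap _ _ _ _ _ _ 13 (by norm_num) (by norm_num) (by norm_num) h9 h9)
    · have a5 := (order_eq_nat.1 he).2 5 (by norm_num)
      have e7 := e0.2.2.2.2.1
      rw [a5] at e7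
      exact mul_ne_zero hae hys (by linear_combination e7)
    · exact not13 (hgap _ _ _ _ _ _ 13 (by norm_num) (by norm_num) (by norm_num) h11 h11)
  · exfalso
    have y1 := hylow 1 (by norm_num)
    have h9 : binom569 m9 m11 (-(coeff 4 y / coeff 2 y)) ∈ I := (hmem _).2 (by
      norm_num [coeff_binom569, -coeff_zero_eq_constantCoeff, hys, y1])
    have h10 : binom569 m10 m11 (-(coeff 3 y / coeff 2 y)) ∈ I := (hmem _).2 (by
      norm_num [coeff_binom569, -coeff_zero_eq_constantCoeff, hys, y1])
    have h12 : binom569 m12 m14 (0 : k) ∈ I := (hmem _).2 (by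
      norm_num [coeff_binom569, -coeff_zero_eq_constantCoeff, y1])
    have := hle _ _ _ (by norm_num) h9
    have a5 : coeff 5 (a : k⟦X⟧) = 0 := by
      have e7 := e0.2.2.2.2.1
      rw [y1] at e7
      exact (mul_eq_zero.1 (by linear_combination e7 : _ * coeff 2 y = 0)).resolve_right hys
    have a6 : coeff 6 (a : k⟦X⟧) = 0 := by
      have e8 := e0.2.2.2.2.2.1
      rw [a5] at e8
      exact (mul_eq_zero.1 (by linear_combination e8 : _ * coeff 2 y = 0)).resolve_right hys
    obtain rfl | rfl | rfl : e = 5 ∨ e = 6 ∨ e = 9 := by omega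
    · exact hae a5
    · exact hae a6
    · exact not13 (hgap _ _ _ _ _ _ 13 (by norm_num) (by norm_num) (by norm_num) h10 h12)
  · have y1 := hylow 1 (by norm_num)
    have y2 := hylow 2 (by norm_num)
    -- For `s = 3`, gaps `3` and `8` give `c₀ = c₅ = 0`, and gap `13` reads `c₆y₇ + c₉y₄ + c₁₀y₃ =
    -- 0`; solving for `c₁₀` gives `α` and `β`.
    have hideal : I = ideal569 (-(coeff 7 y / coeff 3 y)) (-(coeff 4 y / coeff 3 y)) := by
      ext c
      rw [hmem, mem_ideal569_iff, y1, y2]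
      constructor
      · rintro ⟨-, -, e3, -, -, e8, e13⟩
        have c0 := (mul_eq_zero.1 e3).resolve_right hys
        rw [c0] at e8 e13
        have c5 : coeff 5 (c : k⟦X⟧) = 0 :=
          (mul_eq_zero.1 (by linear_combination e8 : _ * coeff 3 y = 0)).resolve_right hys
        rw [c5] at e13
        refine ⟨c0, c5, ?_⟩
        field_simp
        linear_combination e13
      · rintro ⟨c0, c5, c10⟩
        rw [c0, c5, c10]
        refine ⟨by ring, by ring, by ring, by ring, by ring, by ring, ?_⟩
        field_simp
        ring
    rw [hideal] at ha h2
    exact ⟨_, _, two_mul_eq_zero_of_sq_eq ha0 ha h2, hideal⟩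
  · exfalso
    have y1 := hylow 1 (by norm_num)
    have y2 := hylow 2 (by norm_num)
    have y3 := hylow 3 (by norm_num)
    have h5 : binom569 m5 m9 (-(coeff 8 y / coeff 4 y)) ∈ I := (hmem _).2 (by
      norm_num [coeff_binom569, -coeff_zero_eq_constantCoeff, hys, y1, y2, y3])
    have h6 : binom569 m6 m9 (-(coeff 7 y / coeff 4 y)) ∈ I := (hmem _).2 (by
      norm_num [coeff_binom569, -coeff_zero_eq_constantCoeff, hys, y1, y2, y3])
    have := hle _ _ _ (by norm_num) h5
    obtain rfl : e = 5 := by omega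
    exact not7 (hgap _ _ _ _ _ _ 7 (by norm_num) (by norm_num) (by norm_num) h6 h6)
  · exfalso
    have y1 := hylow 1 (by norm_num)
    have y2 := hylow 2 (by norm_num)
    have y3 := hylow 3 (by norm_num)
    have y4 := hylow 4 (by norm_num)
    have h5 : binom569 m5 m6 (-(coeff 8 y / coeff 7 y)) ∈ I := (hmem _).2 (by
      norm_num [coeff_binom569, -coeff_zero_eq_constantCoeff, hys, y1, y2, y3, y4])
    have h9 : binom569 m9 m14 (0 : k) ∈ I := (hmem _).2 (by
      norm_num [coeff_binom569, -coeff_zero_eq_constantCoeff, y1, y2, y3, y4])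
    have := hle _ _ _ (by norm_num) h5
    obtain rfl : e = 5 := by omega
    exact not13 (hgap _ _ _ _ _ _ 13 (by norm_num) (by norm_num) (by norm_num) h9 h9)
  · exfalso
    have y1 := hylow 1 (by norm_num)
    have y2 := hylow 2 (by norm_num)
    have y3 := hylow 3 (by norm_num)
    have y4 := hylow 4 (by norm_num)
    have y7 := hylow 7 (by norm_num)
    have h6 : binom569 m6 m14 (0 : k) ∈ I := (hmem _).2 (by
      norm_num [coeff_binom569, -coeff_zero_eq_constantCoeff, y1, y2, y3, y4, y7])
    have h9 : binom569 m9 m14 (0 : k) ∈ I := (hmem _).2 (by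
      norm_num [coeff_binom569, -coeff_zero_eq_constantCoeff, y1, y2, y3, y4, y7])
    have h10 : binom569 m10 m14 (0 : k) ∈ I := (hmem _).2 (by
      norm_num [coeff_binom569, -coeff_zero_eq_constantCoeff, y1, y2, y3, y4, y7])
    have := hle _ _ _ (by norm_num) h6
    have a5 : coeff 5 (a : k⟦X⟧) = 0 := by
      have e13 := e0.2.2.2.2.2.2
      rw [y1, y2, y3, y4, y7] at e13
      exact (mul_eq_zero.1 (by linear_combination e13 : _ * coeff 8 y = 0)).resolve_right hys
    obtain rfl | rfl : e = 5 ∨ e = 6 := by omega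
    · exact hae a5
    -- `9 + 10 = 6 + 13`.
    · exact not13 (hgap _ _ _ _ _ _ 13 (by norm_num) (by norm_num) (by norm_num) h9 h10)
  · exfalso
    have y1 := hylow 1 (by norm_num)
    have y2 := hylow 2 (by norm_num)
    have y3 := hylow 3 (by norm_num)
    have y4 := hylow 4 (by norm_num)
    have y7 := hylow 7 (by norm_num)
    have y8 := hylow 8 (by norm_num)
    have h5 : binom569 m5 m14 (0 : k) ∈ I := (hmem _).2 (by
      norm_num [coeff_binom569, -coeff_zero_eq_constantCoeff, y1, y2, y3, y4, y7, y8])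
    have h6 : binom569 m6 m14 (0 : k) ∈ I := (hmem _).2 (by
      norm_num [coeff_binom569, -coeff_zero_eq_constantCoeff, y1, y2, y3, y4, y7, y8])
    have := hle _ _ _ (by norm_num) h5
    obtain rfl : e = 5 := by omega
    exact not7 (hgap _ _ _ _ _ _ 7 (by norm_num) (by norm_num) (by norm_num) h6 h6)

end Classification

theorem mainTheorem2 (k : Type*) [Field k] :
    ulrichIdeals (semigroupRing k H569) =
        {I | ∃ α β : k, 2 * β = 0 ∧ I = ideal569 α β} ∧
      ∀ I ∈ ulrichIdeals (semigroupRing k H569), ∀ α β α' β' : k,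
        I = ideal569 α β → I = ideal569 α' β' → α = α' ∧ β = β' := by
  refine ⟨Set.ext fun I => ⟨exists_eq_ideal569_of_isUlrichIdeal, ?_⟩, ?_⟩
  · rintro ⟨α, β, hβ, rfl⟩
    exact isUlrichIdeal_ideal569 hβ
  · rintro I - α β α' β' h h'
    exact ideal569_injective (h.symm.trans h')
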